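/- Let $U\subseteq\mathbb C^m$ be open and connected, and let $\mathcal H\neq\{0\}$ be a function Hilbert space on $U$, that is, a complex Hilbert space whose elements are holomorphic functions $f:U\to\mathbb C$ (with pointwise operations) and for which every point evaluation $f\mapsto f(z)$, $z\in U$, is continuous. A multiplier for $\mathcal H$ is a function $\psi:U\to\mathbb C$ such that $\psi f\in\mathcal H$ for all $f\in\mathcal H$; then $M_\psi f=\psi f$ is a bounded operator on $\mathcal H$, and its Hilbert space adjoint $M_\psi^\star$ is called an adjoint multiplication operator. A vector $x\in\mathcal H$ is hypercyclic for a bounded operator $T$ on $\mathcal H$ if $\{T^nx:n\ge 0\}$ is dense in $\mathcal H$, and $T$ is hypercyclic if it has a hypercyclic vector. Let $\mathbb T=\{z\in\mathbb C:|z|=1\}$ and let $\varphi$ be a non-constant multiplier for $\mathcal H$. 1. The family $$\{M^\star_{\overline b+a\varphi}: a>0,\ b\in\mathbb C,\ (\overline b+a\varphi)(U)\cap\mathbb T\neq\varnothing\}$$ has no common hypercyclic vector: no $x\in\mathcal H$ is hypercyclic for every member of it. 2. Suppose moreover that $\varphi$ is holomorphic on $U$, or that the functions in $\mathcal H$ have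 no common zero in $U$ (in which case every multiplier is holomorphic). Then every member of this family is hypercyclic. Consequently there is no vector $x\in\mathcal H$ that is hypercyclic for all hypercyclic adjoint multiplication operators on $\mathcal H$; that is, the question of Godefroy and Shapiro whether the family of all hypercyclic adjoint multiplication operators on $\mathcal H$ has a common hypercyclic vector has a negative answer for $\mathcal H$. -/

import Mathlib

open scoped ComplexConjugate

/-- `x` is a hypercyclic vector for `T`: its orbit `{T ^ n x : n ≥ 0}` is dense. -/
def IsHypercyclicVector {X : Type*} [AddCommMonoid X] [Module ℂ X] [TopologicalSpace X]
    (T : X →L[ℂ] X) (x : X) : Prop :=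
  Dense (Set.range fun n : ℕ => (T ^ n) x)

/-- `T` is hypercyclic: it has a hypercyclic vector. -/
def IsHypercyclic {X : Type*} [AddCommMonoid X] [Module ℂ X] [TopologicalSpace X]
    (T : X →L[ℂ] X) : Prop :=
  ∃ x, IsHypercyclicVector T x

/-- A function given on the points of a set `U` of `ℂ^m` only is holomorphic on `U`. -/
def IsHolomorphic {m : ℕ} {U : Set (EuclideanSpace ℂ (Fin m))} (f : U → ℂ) : Prop :=
  ∃ F : EuclideanSpace ℂ (Fin m) → ℂ, DifferentiableOn ℂ F U ∧ ∀ z : U, F z = f z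

/-- A function Hilbert space on `U ⊆ ℂ^m`: a Hilbert space `H` of functions `U → ℂ` with continuous
point evaluations (this is `RKHS ℂ H U ℂ`), all of whose elements are holomorphic on `U`. -/
class FunctionHilbertSpace {m : ℕ} (U : Set (EuclideanSpace ℂ (Fin m))) (H : Type*)
    [NormedAddCommGroup H] [InnerProductSpace ℂ H] [CompleteSpace H] [RKHS ℂ H U ℂ] : Prop where
  holomorphic : ∀ f : H, IsHolomorphic (U := U) (fun z => f z)

section Multiplier

variable {X : Type*} {H : Type*} [NormedAddCommGroup H] [InnerProductSpace ℂ H]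
  [RKHS ℂ H X ℂ]

/-- `φ` is a multiplier for `H`: `φ f ∈ H` for every `f ∈ H`. -/
def IsMultiplier (H : Type*) [NormedAddCommGroup H] [InnerProductSpace ℂ H]
    [RKHS ℂ H X ℂ] (φ : X → ℂ) : Prop :=
  ∀ f : H, ∃ g : H, ∀ z, g z = φ z * f z

/-- If `φ` is a multiplier, so is `c + a φ`. -/
theorem IsMultiplier.affine {φ : X → ℂ} (hφ : IsMultiplier H φ) (c a : ℂ) :
    IsMultiplier H (fun z => c + a * φ z) := by
  intro f
  obtain ⟨g, hg⟩ := hφ f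
  refine ⟨c • f + a • g, fun z => ?_⟩
  simp [hg]
  ring

/-- The product `φ f` as an element of `H`. -/
noncomputable def mulFun {φ : X → ℂ} (hφ : IsMultiplier H φ) (f : H) : H :=
  (hφ f).choose

theorem mulFun_apply {φ : X → ℂ} (hφ : IsMultiplier H φ) (f : H) (z : X) :
    mulFun hφ f z = φ z * f z :=
  (hφ f).choose_spec z

/-- Multiplication by a multiplier, as a linear map. -/
noncomputable def mulLin {φ : X → ℂ} (hφ : IsMultiplier H φ) : H →ₗ[ℂ] H where
  toFun := mulFun hφ
  map_add' f g := by
    refine RKHS.ext fun z => ?_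
    simp only [mulFun_apply, RKHS.coe_add, Pi.add_apply]
    ring
  map_smul' c f := by
    refine RKHS.ext fun z => ?_
    simp only [mulFun_apply, RKHS.coe_smul, Pi.smul_apply, smul_eq_mul, RingHom.id_apply]
    ring

theorem mulLin_apply {φ : X → ℂ} (hφ : IsMultiplier H φ) (f : H) (z : X) :
    mulLin hφ f z = φ z * f z :=
  mulFun_apply hφ f z

variable [CompleteSpace H]

/-- The multiplication operator `M_φ f = φ f`, continuous by the closed graph theorem. -/
noncomputable def mulOp {φ : X → ℂ} (hφ : IsMultiplier H φ) : H →L[ℂ] H :=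
  ContinuousLinearMap.ofIsClosedGraph (g := mulLin hφ) (by
    have h : ((mulLin hφ).graph : Set (H × H)) =
        ⋂ z, {p : H × H | p.2 z = φ z * p.1 z} := by
      ext p
      simp only [SetLike.mem_coe, LinearMap.mem_graph_iff, Set.mem_iInter, Set.mem_ofPred_eq]
      constructor
      · intro hp z
        rw [hp, mulLin_apply]
      · intro hp
        refine RKHS.ext fun z => ?_
        rw [hp, mulLin_apply]
    rw [h]
    refine isClosed_iInter fun z => isClosed_eq ?_ ?_
    · exact (RKHS.continuous_eval z).comp continuous_snd
    · exact continuous_const.mul ((RKHS.continuous_eval z).comp continuous_fst))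

theorem mulOp_apply {φ : X → ℂ} (hφ : IsMultiplier H φ) (f : H) (z : X) :
    mulOp hφ f z = φ z * f z :=
  mulLin_apply hφ f z

/-- The adjoint multiplication operator: the Hilbert space adjoint of `M_φ`. -/
noncomputable def adjMulOp {φ : X → ℂ} (hφ : IsMultiplier H φ) : H →L[ℂ] H :=
  ContinuousLinearMap.adjoint (mulOp hφ)

end Multiplier

/-! Put `S = M_φ*`, so the family consists of operators `T = a (S + c)` with `c = b / a`. For a
functional `f` with `f x ≠ 0`, `p_n(c) = f ((S + c)^n x)` is a polynomial of degree `n` with leading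
coefficient `f x`, `p_{n+1}' = (n+1) p_n`, and `f (T^n x) = a^n p_n(c)`.

If `x` is hypercyclic for every `(a, c)` in an open set, fix `y` with `f y = 0` and `f (T₀ y) = 1`
for one such operator `T₀`. For all nearby parameters the orbit comes close to `y` infinitely often,
and at such times `n` the numbers `a^n p_n`, `a^(n+1) p_{n+1}`, `a^(n+2) p_{n+2}` are near `0`, near
`1`, and bounded. Then `q = p_{n+2} / p_{n+1}` is bounded with `|q'| ≥ (n+2)/2`; as `q` is at most
`(n+2)`-to-one, comparing areas confines `c` to a set of area `O(1/n)` (`volume_shift_set_le`). For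
fixed `c`, `a^(n+1) p_{n+1} ≈ 1` confines `a` to length `O(1/n)` (`volume_scaling_set_le`). The
measures `O(1/n²)` are summable, so by Borel–Cantelli almost no parameter works:
`not_common_isHypercyclicVector`.

The open mapping theorem makes the parameter set of the family contain an open set. Hypercyclicity
of each member is the Godefroy–Shapiro criterion applied to reproducing kernels, which are
eigenvectors of adjoint multiplication operators. -/

/-! ### Area comparison for maps of bounded multiplicity -/

open MeasureTheory ENNReal in
/-- If `q` is at most `n`-to-one on `B` with values in `D`, and `|q'| ≥ δ` on `B`, then
`δ² · area B ≤ n · area D`. -/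
theorem sq_mul_volume_le_of_multiplicity_le {q q' : ℂ → ℂ} {B D : Set ℂ} (hB : MeasurableSet B)
    (hq : ∀ z ∈ B, HasDerivAt q (q' z) z) {δ : ℝ} (hδ : 0 < δ) (hq' : ∀ z ∈ B, δ ≤ ‖q' z‖)
    (hBD : Set.MapsTo q B D) {n : ℕ}
    (hn : ∀ w, ∃ R : Finset ℂ, R.card ≤ n ∧ ∀ z ∈ B, q z = w → z ∈ R) :
    ENNReal.ofReal (δ ^ 2) * volume B ≤ n * volume D := by
  classical
  rcases B.eq_empty_or_nonempty with rfl | hne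
  · simp
  let f' : ℂ → ℂ →L[ℝ] ℂ := fun z =>
    (ContinuousLinearMap.toSpanSingleton ℂ (q' z)).restrictScalars ℝ
  have hf'apply : ∀ z h, f' z h = h * q' z := fun z h => by simp [f']
  have hf : ∀ z ∈ B, HasFDerivWithinAt q (f' z) B z := fun z hz =>
    ((hq z hz).hasFDerivAt.restrictScalars ℝ).hasFDerivWithinAt
  have hdet : ∀ z, |(f' z).det| = ‖q' z‖ ^ 2 := by
    intro z
    have h1 : ((f' z : ℂ →L[ℝ] ℂ) : ℂ →ₗ[ℝ] ℂ) = Algebra.lmul ℝ ℂ (q' z) := by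
      ext
      simp [hf'apply, mul_comm]
    have h2 : (f' z).det = Algebra.norm ℝ (q' z) := by
      rw [Algebra.norm_apply, ← h1, ContinuousLinearMap.det]
    rw [h2, Algebra.norm_complex_eq]
    simp [Complex.normSq_eq_norm_sq]
  have hnorm : ∀ z ∈ B, f' z ≠ 0 := by
    intro z hz h0
    have := hf'apply z 1
    rw [h0] at this
    have h3 := hq' z hz
    simp at this
    rw [← this] at h3
    simp at h3
    linarith
  -- Approximation within `‖A‖ / 2` forces injectivity on each piece, since a complex multiplication
  -- `A` scales all vectors by `‖A‖`. The value `1` at `A = 0` only keeps the tolerance nonzero: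
  -- every `A` that occurs is a derivative at a point of `B`.
  obtain ⟨t, A, htd, htm, htc, happ, hA⟩ :=
    exists_partition_approximatesLinearOn_of_hasFDerivWithinAt q B f' hf
      (fun A => if A = 0 then 1 else ‖A‖₊ / 2) (by
        intro A
        split_ifs with h
        · exact one_ne_zero
        · simpa using h)
  have hinj : ∀ i, Set.InjOn q (B ∩ t i) := by
    intro i x hx y hy hxy
    obtain ⟨z, hz, hAz⟩ := hA hne i
    have h1 := happ i x hx y hy
    rw [hAz, if_neg (hnorm z hz), hxy, sub_self, zero_sub, norm_neg, hf'apply, norm_mul] at h1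
    have h2 : ‖f' z‖ ≤ ‖q' z‖ := by
      refine ContinuousLinearMap.opNorm_le_bound _ (norm_nonneg _) fun h => ?_
      rw [hf'apply, norm_mul, mul_comm]
    have h3 : 0 < ‖q' z‖ := hδ.trans_le (hq' z hz)
    have h4 : ((‖f' z‖₊ / 2 : NNReal) : ℝ) = ‖f' z‖ / 2 := by simp
    rw [h4] at h1
    by_contra hne'
    have h5 : 0 < ‖x - y‖ := norm_pos_iff.2 (sub_ne_zero.2 hne')
    nlinarith [mul_le_mul_of_nonneg_right h2 h5.le, mul_pos h3 h5]
  have hmeas : ∀ i, MeasurableSet (B ∩ t i) := fun i => hB.inter (htm i)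
  have himg : ∀ i, MeasurableSet (q '' (B ∩ t i)) := fun i =>
    measurable_image_of_fderivWithin (hmeas i)
      (fun z hz => (hf z hz.1).mono Set.inter_subset_left) (hinj i)
  have hpiece : ∀ i, ENNReal.ofReal (δ ^ 2) * volume (B ∩ t i) ≤
      ∫⁻ w in D, (q '' (B ∩ t i)).indicator 1 w := by
    intro i
    rw [lintegral_indicator_one (himg i), Measure.restrict_apply (himg i),
      Set.inter_eq_left.2 (Set.image_subset_iff.2 fun z hz => hBD hz.1 :
        q '' (B ∩ t i) ⊆ D),
      ← lintegral_abs_det_fderiv_eq_addHaar_image volume (hmeas i)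
        (fun z hz => (hf z hz.1).mono Set.inter_subset_left) (hinj i),
      ← setLIntegral_const]
    refine setLIntegral_mono' (hmeas i) fun z hz => ENNReal.ofReal_le_ofReal ?_
    rw [hdet]
    exact pow_le_pow_left₀ hδ.le (hq' z hz.1) 2
  -- The sum counts the pieces whose image contains `w`; disjoint pieces supply distinct preimages
  -- of `w`.
  have hsum : ∀ w, ∑' i, (q '' (B ∩ t i)).indicator (1 : ℂ → ℝ≥0∞) w ≤ n := by
    intro w
    obtain ⟨R, hR, hRw⟩ := hn w
    refine ENNReal.summable.tsum_le_of_sum_le fun s => ?_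
    have h1 : ∑ i ∈ s, (q '' (B ∩ t i)).indicator (1 : ℂ → ℝ≥0∞) w =
        ((s.filter fun i => w ∈ q '' (B ∩ t i)).card : ℝ≥0∞) := by
      simp [Set.indicator_apply]
    rw [h1, Nat.cast_le]
    refine le_trans ?_ hR
    have h2 : ∀ i ∈ s.filter fun i => w ∈ q '' (B ∩ t i), ∃ z, z ∈ B ∩ t i ∧ q z = w :=
      fun i hi => (Finset.mem_filter.1 hi).2
    choose! g hg using h2
    refine Finset.card_le_card_of_injOn g (fun i hi => hRw _ (hg i hi).1.1 (hg i hi).2) ?_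
    intro i hi j hj hij
    by_contra hne'
    exact Set.disjoint_left.1 (htd hne') (hg i hi).1.2 (hij ▸ (hg j hj).1.2)
  calc ENNReal.ofReal (δ ^ 2) * volume B
      ≤ ENNReal.ofReal (δ ^ 2) * ∑' i, volume (B ∩ t i) := by
        gcongr
        refine le_trans (measure_mono ?_) (measure_iUnion_le _)
        rw [← Set.inter_iUnion]
        exact Set.subset_inter subset_rfl htc
    _ = ∑' i, ENNReal.ofReal (δ ^ 2) * volume (B ∩ t i) := ENNReal.tsum_mul_left.symm
    _ ≤ ∑' i, ∫⁻ w in D, (q '' (B ∩ t i)).indicator 1 w := ENNReal.tsum_le_tsum hpiece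
    _ = ∫⁻ w in D, ∑' i, (q '' (B ∩ t i)).indicator 1 w :=
        (lintegral_tsum fun i => (measurable_one.indicator (himg i)).aemeasurable).symm
    _ ≤ ∫⁻ _ in D, n := lintegral_mono hsum
    _ = n * volume D := setLIntegral_const _ _

/-! ### Orbits of shifted operators and their polynomials -/

section CommonHypercyclic

theorem not_dense_range_pow_mul (l c : ℂ) : ¬ Dense (Set.range fun n : ℕ => l ^ n * c) := by
  intro h
  rcases le_or_gt ‖l‖ 1 with hl | hl
  · have h1 : Set.range (fun n : ℕ => l ^ n * c) ⊆ Metric.closedBall 0 ‖c‖ := by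
      rintro _ ⟨n, rfl⟩
      simpa using mul_le_of_le_one_left (norm_nonneg c) (pow_le_one₀ (norm_nonneg l) hl)
    have h2 := closure_minimal h1 Metric.isClosed_closedBall
    rw [h.closure_eq] at h2
    have h3 := h2 (Set.mem_univ ((‖c‖ + 1 : ℝ) : ℂ))
    rw [mem_closedBall_zero_iff, Complex.norm_real, Real.norm_of_nonneg (by positivity)] at h3
    linarith
  · by_cases hc : c = 0
    · subst hc
      simp only [mul_zero, Set.range_const] at h
      have h2 := h.closure_eq
      rw [closure_singleton] at h2
      have h3 : (1 : ℂ) ∈ ({0} : Set ℂ) := h2 ▸ Set.mem_univ _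
      simp at h3
    · obtain ⟨_, ⟨n, rfl⟩, hy⟩ :=
        h.exists_mem_open Metric.isOpen_ball ⟨0, Metric.mem_ball_self (norm_pos_iff.2 hc)⟩
      rw [mem_ball_zero_iff, norm_mul, norm_pow] at hy
      nlinarith [one_le_pow₀ hl.le (n := n), norm_pos_iff.2 hc]

variable {X : Type*} [NormedAddCommGroup X] [NormedSpace ℂ X]

/-- The dual of an operator with a hypercyclic vector has no eigenvectors. -/
theorem IsHypercyclicVector.eq_zero_of_eigenfunctional {T : X →L[ℂ] X} {x : X}
    (hx : IsHypercyclicVector T x) {f : X →L[ℂ] ℂ} {l : ℂ} (hf : ∀ v, f (T v) = l * f v) :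
    f = 0 := by
  by_contra h0
  have hsurj : Function.Surjective f := by
    obtain ⟨v, hv⟩ : ∃ v, f v ≠ 0 := by
      by_contra! h
      exact h0 (ContinuousLinearMap.ext h)
    exact fun c => ⟨(c / f v) • v, by simp [hv]⟩
  have hpow : ∀ n : ℕ, f ((T ^ n) x) = l ^ n * f x := by
    intro n
    induction n with
    | zero => simp
    | succ n ih => rw [pow_succ', mul_apply_eq_comp, hf, ih]; ring
  refine not_dense_range_pow_mul l (f x) ?_
  have h1 := hsurj.denseRange.dense_image f.continuous hx
  rw [← Set.range_comp] at h1
  have h2 : (fun n : ℕ => l ^ n * f x) = f ∘ fun n : ℕ => (T ^ n) x :=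
    funext fun n => (hpow n).symm
  rwa [h2]

/-- A nontrivial space has no isolated points, so an orbit stays dense after finitely many points
are removed. -/
theorem IsHypercyclicVector.frequently_mem [Nontrivial X] {T : X →L[ℂ] X} {x : X}
    (hx : IsHypercyclicVector T x) {V : Set X} (hV : IsOpen V) (hne : V.Nonempty) :
    ∃ᶠ n : ℕ in Filter.atTop, (T ^ n) x ∈ V := by
  rw [Filter.frequently_atTop]
  intro N
  have : ∀ v : X, (nhdsWithin v {v}ᶜ).NeBot := fun v => Module.punctured_nhds_neBot ℂ X v
  have h1 := Dense.sdiff_finite hx ((Finset.range N).finite_toSet.image fun n : ℕ => (T ^ n) x)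
  obtain ⟨_, ⟨⟨n, rfl⟩, hn⟩, hv⟩ := h1.exists_mem_open hV hne
  refine ⟨n, ?_, hv⟩
  by_contra! h
  exact hn ⟨n, by simpa using h, rfl⟩

/-- This Appell relation makes the numerator of `(p_{n+2} / p_{n+1})'` a combination of `p_{n+1}²`
and `p_{n+2} p_n`. The induction runs over all `f`, because splitting off one factor `S + c`
replaces `f` by `f ∘ S`. -/
theorem hasDerivAt_functional_pow_shift (S : X →L[ℂ] X) (x : X) (n : ℕ) (f : X →L[ℂ] ℂ) (c : ℂ) :
    HasDerivAt (fun c : ℂ => f (((S + c • 1) ^ (n + 1)) x))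
      ((n + 1) * f (((S + c • 1) ^ n) x)) c := by
  induction n generalizing f with
  | zero =>
    simp only [zero_add, pow_one, add_apply, smul_apply,
      one_apply_eq_self, map_add, map_smul, smul_eq_mul, pow_zero, Nat.cast_zero]
    exact ((hasDerivAt_id c).mul_const (f x)).const_add (f (S x))
  | succ n ih =>
    have h1 : ∀ (g : X →L[ℂ] ℂ) (c : ℂ) (k : ℕ), g (((S + c • 1) ^ (k + 1)) x) =
        (g.comp S) (((S + c • 1) ^ k) x) + c * g (((S + c • 1) ^ k) x) := by
      intro g c k
      rw [pow_succ', mul_apply_eq_comp]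
      simp
    have h2 := (ih (f.comp S)).add ((hasDerivAt_id c).mul (ih f))
    have h3 : (fun c : ℂ => f (((S + c • 1) ^ (n + 1 + 1)) x)) =
        fun c : ℂ => (f.comp S) (((S + c • 1) ^ (n + 1)) x) + id c * f (((S + c • 1) ^ (n + 1)) x) :=
      funext fun c => h1 f c (n + 1)
    rw [h3]
    refine h2.congr_deriv ?_
    have h4 := h1 f c n
    simp only [id, Nat.cast_add, Nat.cast_one]
    linear_combination (-(n + 1 : ℂ)) * h4

open Polynomial in
theorem exists_polynomial_functional_pow_shift (S : X →L[ℂ] X) (x : X) (n : ℕ) (f : X →L[ℂ] ℂ) :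
    ∃ P : ℂ[X], P.natDegree ≤ n ∧ P.coeff n = f x ∧
      ∀ c, P.eval c = f (((S + c • 1) ^ n) x) := by
  induction n generalizing f with
  | zero => exact ⟨C (f x), by simp, by simp, fun c => by simp⟩
  | succ n ih =>
    obtain ⟨P, hP, hPc, hPe⟩ := ih f
    obtain ⟨Q, hQ, hQc, hQe⟩ := ih (f.comp S)
    refine ⟨Q + Polynomial.X * P, ?_, ?_, fun c => ?_⟩
    · refine natDegree_add_le_of_degree_le (hQ.trans n.le_succ) ?_
      refine natDegree_mul_le.trans ?_
      have := natDegree_X_le (R := ℂ)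
      omega
    · rw [coeff_add, coeff_X_mul, hPc, coeff_eq_zero_of_natDegree_lt (Nat.lt_succ_of_le hQ), zero_add]
    · rw [pow_succ', mul_apply_eq_comp]
      simp [hQe, hPe]

open MeasureTheory ENNReal

/-- The shifts at which three consecutive values of the orbit are far from a geometric progression
form a set of area `O(1 / n)`. -/
theorem volume_shift_set_le (S : X →L[ℂ] X) (x : X) (f : X →L[ℂ] ℂ) (hfx : f x ≠ 0) (n : ℕ)
    (K : ℝ) {B : Set ℂ} (hB : MeasurableSet B)
    (h1 : ∀ c ∈ B, f (((S + c • 1) ^ (n + 1)) x) ≠ 0)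
    (h2 : ∀ c ∈ B, ‖f (((S + c • 1) ^ (n + 2)) x) / f (((S + c • 1) ^ (n + 1)) x)‖ ≤ K)
    (h3 : ∀ c ∈ B, ‖f (((S + c • 1) ^ (n + 2)) x) * f (((S + c • 1) ^ n) x)‖ ≤
      ‖f (((S + c • 1) ^ (n + 1)) x)‖ ^ 2 / 2) :
    volume B ≤ ENNReal.ofReal (4 / (n + 2)) * volume (Metric.closedBall (0 : ℂ) K) := by
  set p : ℕ → ℂ → ℂ := fun k c => f (((S + c • 1) ^ k) x) with hp
  have hd : ∀ k c, HasDerivAt (p (k + 1)) ((k + 1) * p k c) c := fun k c =>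
    hasDerivAt_functional_pow_shift S x k f c
  have h4 := sq_mul_volume_le_of_multiplicity_le (q := fun c => p (n + 2) c / p (n + 1) c)
    (D := Metric.closedBall (0 : ℂ) K) (n := n + 2) (δ := (n + 2) / 2) hB
    (fun c hc => (hd (n + 1) c).div (hd n c) (h1 c hc)) (by positivity) ?_
    (fun c hc => mem_closedBall_zero_iff.2 (h2 c hc)) ?_
  · have h5 : volume B = ENNReal.ofReal (4 / (n + 2) ^ 2) *
        (ENNReal.ofReal (((n + 2) / 2) ^ 2) * volume B) := by
      rw [← mul_assoc, ← ENNReal.ofReal_mul (by positivity)]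
      have : (4 / (n + 2) ^ 2 * ((n + 2) / 2) ^ 2 : ℝ) = 1 := by field_simp; norm_num
      rw [this]
      simp
    rw [h5]
    refine (mul_le_mul_right h4 _).trans (le_of_eq ?_)
    rw [← mul_assoc]
    congr 1
    have h6 : ((n + 2 : ℕ) : ℝ≥0∞) = ENNReal.ofReal (n + 2) := by
      rw [← ENNReal.ofReal_natCast]; push_cast; rfl
    rw [h6, ← ENNReal.ofReal_mul (by positivity)]
    congr 1
    field_simp
  · intro c hc
    have hpos : 0 < ‖p (n + 1) c‖ := norm_pos_iff.2 (h1 c hc)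
    rw [norm_div, norm_pow, le_div_iff₀ (by positivity)]
    have h5 : ‖p (n + 2) c * p n c‖ ≤ ‖p (n + 1) c‖ ^ 2 / 2 := h3 c hc
    -- After division by `|p_{n+1}|²`, the lower bound is `(n+2) - (n+1)/2 ≥ (n+2)/2`.
    have h6 : ((↑(n + 1) + 1) * p (n + 1) c * p (n + 1) c - p (n + 2) c * ((↑n + 1) * p n c) : ℂ) =
        (n + 2 : ℕ) * p (n + 1) c ^ 2 - (n + 1 : ℕ) * (p (n + 2) c * p n c) := by
      push_cast; ring
    rw [h6]
    have h7 := norm_sub_norm_le ((n + 2 : ℕ) * p (n + 1) c ^ 2 : ℂ)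
      ((n + 1 : ℕ) * (p (n + 2) c * p n c))
    rw [norm_mul ((n + 2 : ℕ) : ℂ), norm_mul ((n + 1 : ℕ) : ℂ), Complex.norm_natCast,
      Complex.norm_natCast, norm_pow] at h7
    refine le_trans ?_ h7
    push_cast
    nlinarith [mul_le_mul_of_nonneg_left h5 (by positivity : (0 : ℝ) ≤ n + 1), sq_nonneg ‖p (n + 1) c‖]
  -- The fibre over `w` lies among the roots of `p_{n+2} - w p_{n+1}`, which is nonzero of degree at
  -- most `n + 2` because its top coefficient is `f x`.
  · intro w
    obtain ⟨P, hP, hPc, hPe⟩ := exists_polynomial_functional_pow_shift S x (n + 2) f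
    obtain ⟨Q, hQ, -, hQe⟩ := exists_polynomial_functional_pow_shift S x (n + 1) f
    have hdeg : (P - Polynomial.C w * Q).natDegree ≤ n + 2 :=
      (Polynomial.natDegree_sub_le_of_le hP
        ((Polynomial.natDegree_C_mul_le _ _).trans (hQ.trans (Nat.le_succ _)))).trans
        (max_self _).le
    have hne : P - Polynomial.C w * Q ≠ 0 := by
      intro h0
      have := congrArg (fun R => Polynomial.coeff R (n + 2)) h0
      simp only [Polynomial.coeff_sub, Polynomial.coeff_C_mul, Polynomial.coeff_zero, hPc,
        Polynomial.coeff_eq_zero_of_natDegree_lt (Nat.lt_succ_of_le hQ)] at this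
      exact hfx (by simpa using this)
    refine ⟨(P - Polynomial.C w * Q).roots.toFinset,
      (Multiset.toFinset_card_le _).trans ((Polynomial.card_roots' _).trans hdeg), ?_⟩
    intro c hc hcw
    rw [Multiset.mem_toFinset, Polynomial.mem_roots hne, Polynomial.IsRoot.def]
    rw [div_eq_iff (h1 c hc)] at hcw
    simp only [Polynomial.eval_sub, Polynomial.eval_mul, Polynomial.eval_C, hPe, hQe]
    exact sub_eq_zero.2 hcw

end CommonHypercyclic

/-! ### Borel–Cantelli in the two parameters -/

section CommonHypercyclicFamily

open MeasureTheory ENNReal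

theorem volume_scaling_set_le (M : ℝ) (k : ℕ) (p : ℂ) :
    volume {a : ℝ | 0 < a ∧ a < M ∧ ‖(a : ℂ) ^ (k + 1) * p - 1‖ < 1 / 2} ≤
      ENNReal.ofReal (2 * M / (k + 1)) := by
  refine (Real.volume_le_diam _).trans (Metric.ediam_le_of_forall_dist_le ?_)
  have key : ∀ a b : ℝ, a ≤ b → 0 < a → a < M → ‖(a : ℂ) ^ (k + 1) * p - 1‖ < 1 / 2 →
      ‖(b : ℂ) ^ (k + 1) * p - 1‖ < 1 / 2 → b - a ≤ 2 * M / (k + 1) := by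
    intro a b hab ha haM h1 h2
    have h3 : 1 / 2 < a ^ (k + 1) * ‖p‖ := by
      have := norm_sub_norm_le (1 : ℂ) ((a : ℂ) ^ (k + 1) * p)
      rw [norm_sub_rev, norm_one, norm_mul, norm_pow,
        Complex.norm_real, Real.norm_of_nonneg ha.le] at this
      linarith
    have h4 : b ^ (k + 1) * ‖p‖ < 3 / 2 := by
      have := norm_sub_norm_le ((b : ℂ) ^ (k + 1) * p) 1
      rw [norm_one, norm_mul, norm_pow, Complex.norm_real,
        Real.norm_of_nonneg (ha.le.trans hab)] at this
      linarith
    -- Bernoulli's inequality turns `(b/a)^(k+1) < (3/2) / (1/2) = 3` into `(k+1) (b-a)/a < 2`.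
    have h5 := one_add_mul_le_pow (a := (b - a) / a)
      (by have := div_nonneg (sub_nonneg.2 hab) ha.le; linarith) (k + 1)
    have h6 : 1 + (b - a) / a = b / a := by field_simp; ring
    rw [h6, div_pow] at h5
    have h7 : b ^ (k + 1) / a ^ (k + 1) < 3 := by
      rw [div_lt_iff₀ (by positivity)]
      have hp : 0 < ‖p‖ := by
        by_contra! hp
        have : ‖p‖ = 0 := le_antisymm hp (norm_nonneg p)
        rw [this] at h3
        norm_num at h3
      refine lt_of_mul_lt_mul_right (a := ‖p‖) ?_ hp.le
      linarith
    have h8 : ((k + 1 : ℕ) : ℝ) * ((b - a) / a) < 2 := by linarith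
    rw [le_div_iff₀ (by positivity)]
    rw [mul_div_assoc', div_lt_iff₀ ha] at h8
    push_cast at h8
    linarith
  rintro a ⟨ha, haM, h1⟩ b ⟨hb, hbM, h2⟩
  rcases le_total a b with h | h
  · rw [dist_comm, Real.dist_eq, abs_of_nonneg (sub_nonneg.2 h)]
    exact key a b h ha haM h1 h2
  · rw [Real.dist_eq, abs_of_nonneg (sub_nonneg.2 h)]
    exact key b a h hb hbM h2 h1

/-- Removes the powers of `a` from the orbit estimates. They cancel between `u₂ u₀` and `u₁²`, where
`1/8 = (1/2)²/2`; in `u₂ / u₁` one factor `1/a < 2/a₀` survives, and `|a^(n+1) u₁| > 1/2`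
contributes the other `2` of `4K/a₀`. -/
theorem scaling_estimates {a₀ a K : ℝ} (ha₀ : 0 < a₀) (ha : a₀ / 2 < a) {n : ℕ} {u₀ u₁ u₂ : ℂ}
    (h1 : ‖(a : ℂ) ^ (n + 1) * u₁ - 1‖ < 1 / 2) (h2 : ‖(a : ℂ) ^ (n + 2) * u₂‖ < K)
    (h3 : ‖(a : ℂ) ^ (n + 2) * u₂ * ((a : ℂ) ^ n * u₀)‖ < 1 / 8) :
    u₁ ≠ 0 ∧ ‖u₂ / u₁‖ ≤ 4 * K / a₀ ∧ ‖u₂ * u₀‖ ≤ ‖u₁‖ ^ 2 / 2 := by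
  have ha' : 0 < a := by linarith
  have h4 : 1 / 2 < a ^ (n + 1) * ‖u₁‖ := by
    have := norm_sub_norm_le (1 : ℂ) ((a : ℂ) ^ (n + 1) * u₁)
    rw [norm_sub_rev, norm_one, norm_mul, norm_pow,
      Complex.norm_real, Real.norm_of_nonneg ha'.le] at this
    linarith
  have hA : 0 < a ^ (n + 1) := by positivity
  have hu : 0 < ‖u₁‖ := by
    by_contra! hu
    have : ‖u₁‖ = 0 := le_antisymm hu (norm_nonneg _)
    rw [this] at h4
    norm_num at h4
  rw [norm_mul, norm_pow, Complex.norm_real, Real.norm_of_nonneg ha'.le] at h2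
  have h5 : (a : ℂ) ^ (n + 2) * u₂ * ((a : ℂ) ^ n * u₀) = ((a : ℂ) ^ (n + 1)) ^ 2 * (u₂ * u₀) := by
    ring
  rw [h5, norm_mul, norm_pow, norm_pow, Complex.norm_real, Real.norm_of_nonneg ha'.le] at h3
  refine ⟨norm_pos_iff.1 hu, ?_, ?_⟩
  · rw [norm_div, div_le_div_iff₀ hu ha₀]
    have hK : 0 < K := lt_of_le_of_lt (by positivity) h2
    have h6 : a ^ (n + 1) * (‖u₂‖ * a₀) ≤ a ^ (n + 1) * (4 * K * ‖u₁‖) := by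
      have h7 : a ^ (n + 2) * ‖u₂‖ = a ^ (n + 1) * ‖u₂‖ * a := by ring
      have h8 : 0 ≤ a ^ (n + 1) * ‖u₂‖ := by positivity
      nlinarith [mul_le_mul_of_nonneg_left ha.le h8]
    exact le_of_mul_le_mul_left h6 hA
  · refine le_of_mul_le_mul_left (a := (a ^ (n + 1)) ^ 2) ?_ (by positivity)
    nlinarith [mul_self_le_mul_self (by norm_num) h4.le]

variable {X : Type*} [NormedAddCommGroup X] [NormedSpace ℂ X]

theorem continuous_functional_pow_shift (S : X →L[ℂ] X) (x : X) (f : X →L[ℂ] ℂ) (n : ℕ) :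
    Continuous fun c : ℂ => f (((S + c • 1) ^ n) x) := by
  obtain ⟨P, -, -, hP⟩ := exists_polynomial_functional_pow_shift S x n f
  simpa only [hP] using P.continuous

theorem volume_scaling_shift_set_le (S : X →L[ℂ] X) (x : X) (f : X →L[ℂ] ℂ) (hfx : f x ≠ 0)
    (M K : ℝ) (n : ℕ) :
    volume {p : ℝ × ℂ | 0 < p.1 ∧ p.1 < M ∧
      ‖(p.1 : ℂ) ^ (n + 1) * f (((S + p.2 • 1) ^ (n + 1)) x) - 1‖ < 1 / 2 ∧
      f (((S + p.2 • 1) ^ (n + 1)) x) ≠ 0 ∧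
      ‖f (((S + p.2 • 1) ^ (n + 2)) x) / f (((S + p.2 • 1) ^ (n + 1)) x)‖ ≤ K ∧
      ‖f (((S + p.2 • 1) ^ (n + 2)) x) * f (((S + p.2 • 1) ^ n) x)‖ ≤
        ‖f (((S + p.2 • 1) ^ (n + 1)) x)‖ ^ 2 / 2} ≤
    ENNReal.ofReal (8 * M / (n + 1) ^ 2) * volume (Metric.closedBall (0 : ℂ) K) := by
  rcases le_or_gt M 0 with hM | hM
  · refine (le_of_eq ?_).trans zero_le
    convert measure_empty (μ := (volume : Measure (ℝ × ℂ)))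
    ext p
    simp only [Set.mem_ofPred_eq, Set.mem_empty_iff_false, iff_false]
    rintro ⟨h1, h2, -⟩
    linarith
  have hc : ∀ k : ℕ, Measurable fun c : ℂ => f (((S + c • 1) ^ k) x) := fun k =>
    (continuous_functional_pow_shift S x f k).measurable
  set B : Set ℂ := {c | f (((S + c • 1) ^ (n + 1)) x) ≠ 0 ∧
      ‖f (((S + c • 1) ^ (n + 2)) x) / f (((S + c • 1) ^ (n + 1)) x)‖ ≤ K ∧
      ‖f (((S + c • 1) ^ (n + 2)) x) * f (((S + c • 1) ^ n) x)‖ ≤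
        ‖f (((S + c • 1) ^ (n + 1)) x)‖ ^ 2 / 2} with hBdef
  have hB : MeasurableSet B := by
    refine ((measurableSet_eq_fun (hc _) measurable_const).compl).inter
      ((measurableSet_le ((hc _).div (hc _)).norm measurable_const).inter
      (measurableSet_le ((hc _).mul (hc _)).norm (((hc _).norm.pow_const 2).div_const 2)))
  set E : Set (ℝ × ℂ) := {p : ℝ × ℂ | 0 < p.1 ∧ p.1 < M ∧
      ‖(p.1 : ℂ) ^ (n + 1) * f (((S + p.2 • 1) ^ (n + 1)) x) - 1‖ < 1 / 2 ∧ p.2 ∈ B}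
  have hE : MeasurableSet E := by
    refine (measurableSet_lt measurable_const measurable_fst).inter
      ((measurableSet_lt measurable_fst measurable_const).inter
      ((measurableSet_lt (Measurable.norm (Measurable.sub_const ?_ 1)) measurable_const).inter
      (measurable_snd hB)))
    exact ((Complex.measurable_ofReal.comp measurable_fst).pow_const _).mul
      ((hc (n + 1)).comp measurable_snd)
  change volume E ≤ _
  rw [Measure.volume_eq_prod, Measure.prod_apply_symm hE]
  -- Tonelli: the slice over each `c` has length `O(1/n)`, and is empty unless `c` lies in `B`, of
  -- area `O(1/n)`.
  calc ∫⁻ c, volume ((fun a : ℝ => (a, c)) ⁻¹' E)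
      ≤ ∫⁻ c, B.indicator (fun _ => ENNReal.ofReal (2 * M / (n + 1))) c := by
        refine lintegral_mono fun c => ?_
        by_cases hcB : c ∈ B
        · rw [Set.indicator_of_mem hcB]
          refine le_trans (measure_mono ?_)
            (volume_scaling_set_le M n (f (((S + c • 1) ^ (n + 1)) x)))
          rintro a ⟨h1, h2, h3, -⟩
          exact ⟨h1, h2, h3⟩
        · rw [Set.indicator_of_notMem hcB]
          have : (fun a : ℝ => (a, c)) ⁻¹' E = ∅ :=
            Set.eq_empty_of_forall_notMem fun a h => hcB h.2.2.2
          rw [this, measure_empty]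
    _ = ENNReal.ofReal (2 * M / (n + 1)) * volume B := lintegral_indicator_const hB _
    _ ≤ ENNReal.ofReal (2 * M / (n + 1)) *
        (ENNReal.ofReal (4 / (n + 2)) * volume (Metric.closedBall (0 : ℂ) K)) := by
        gcongr
        exact volume_shift_set_le S x f hfx n K hB (fun c h => h.1) (fun c h => h.2.1)
          (fun c h => h.2.2)
    _ ≤ ENNReal.ofReal (8 * M / (n + 1) ^ 2) * volume (Metric.closedBall (0 : ℂ) K) := by
        rw [← mul_assoc, ← ENNReal.ofReal_mul (by positivity)]
        gcongr
        rw [div_mul_div_comm, div_le_div_iff₀ (by positivity) (by positivity)]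
        nlinarith [mul_nonneg hM.le (by positivity : (0 : ℝ) ≤ n + 1)]

/-- If the set of pairs `(a, c)` has an interior point with `a > 0`, the operators `a (S + c)` have
no common hypercyclic vector. -/
theorem not_common_isHypercyclicVector [Nontrivial X] (S : X →L[ℂ] X) {Ω : Set (ℝ × ℂ)}
    {p₀ : ℝ × ℂ} (hΩ : Ω ∈ nhds p₀) (hp₀ : 0 < p₀.1) :
    ¬ ∃ x : X, ∀ p ∈ Ω, IsHypercyclicVector ((p.1 : ℂ) • (S + p.2 • 1)) x := by
  rintro ⟨x, hx⟩
  obtain ⟨f, hfx⟩ : ∃ f : X →L[ℂ] ℂ, f x ≠ 0 := by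
    refine SeparatingDual.exists_ne_zero fun hx0 => ?_
    have h1 : Set.range (fun n : ℕ => (((p₀.1 : ℂ) • (S + p₀.2 • 1)) ^ n) x) ⊆ {0} := by
      rintro _ ⟨n, rfl⟩
      rw [hx0]
      exact map_zero _
    obtain ⟨v, hv⟩ := exists_ne (0 : X)
    have h2 := (Dense.mono h1 (hx p₀ (mem_of_mem_nhds hΩ))).closure_eq
    rw [closure_singleton] at h2
    exact hv (h2 ▸ Set.mem_univ v : v ∈ ({0} : Set X))
  set T : ℝ × ℂ → X →L[ℂ] X := fun p => (p.1 : ℂ) • (S + p.2 • 1) with hT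
  -- Otherwise `ker f` is invariant under `T p₀`, so `f` is an eigenvector of the dual operator,
  -- contradicting hypercyclicity.
  obtain ⟨y, hy0, hy1⟩ : ∃ y, f y = 0 ∧ f (T p₀ y) = 1 := by
    by_contra! h
    have h1 : ∀ v, f v = 0 → f (T p₀ v) = 0 := by
      intro v hv
      by_contra h0
      refine h ((f (T p₀ v))⁻¹ • v) ?_ ?_ <;> simp [hv, h0]
    have h2 := (hx p₀ (mem_of_mem_nhds hΩ)).eq_zero_of_eigenfunctional (f := f)
      (l := f (T p₀ x) / f x) (fun v => by
        have := h1 (v - (f v / f x) • x) (by simp [hfx])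
        rw [map_sub, map_sub, map_smul, map_smul, sub_eq_zero, smul_eq_mul] at this
        rw [this]
        ring)
    exact hfx (by rw [h2]; rfl)
  set K : ℝ := ‖f (T p₀ (T p₀ y))‖ + 1
  have hTc : ∀ g : (ℝ × ℂ) × X → X, Continuous g → Continuous fun r => T r.1 (g r) := by
    intro g hg
    have : (fun r : (ℝ × ℂ) × X => T r.1 (g r)) =
        fun r => (r.1.1 : ℂ) • (S (g r) + r.1.2 • g r) := by
      ext r; simp [hT]
    rw [this]
    fun_prop
  have c0 : Continuous fun r : (ℝ × ℂ) × X => f r.2 := by fun_prop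
  have c1' := hTc (fun r => r.2) continuous_snd
  have c1 : Continuous fun r : (ℝ × ℂ) × X => f (T r.1 r.2) := f.continuous.comp c1'
  have c2 : Continuous fun r : (ℝ × ℂ) × X => f (T r.1 (T r.1 r.2)) := f.continuous.comp (hTc _ c1')
  have hev : ∀ᶠ r in nhds (p₀, y), r.1 ∈ Ω ∧ p₀.1 / 2 < r.1.1 ∧ r.1.1 < 2 * p₀.1 ∧
      ‖f (T r.1 r.2) - 1‖ < 1 / 2 ∧ ‖f (T r.1 (T r.1 r.2))‖ < K ∧
      ‖f (T r.1 (T r.1 r.2)) * f r.2‖ < 1 / 8 := by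
    have ca : Continuous fun r : (ℝ × ℂ) × X => r.1.1 := by fun_prop
    refine ((continuous_fst.tendsto (p₀, y)).eventually hΩ).and
      ((continuous_const.tendsto _).eventually_lt (ca.tendsto _) (by simp; linarith) |>.and
      ((ca.tendsto _).eventually_lt (continuous_const.tendsto _) (by simp; linarith) |>.and
      (((c1.sub continuous_const).norm.tendsto _).eventually_lt (continuous_const.tendsto _)
        (by simp [hy1]) |>.and
      ((c2.norm.tendsto _).eventually_lt (continuous_const.tendsto _) (by simp [K]) |>.and
      (((c2.mul c0).norm.tendsto _).eventually_lt (continuous_const.tendsto _)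
        (by simp [hy0]))))))
  -- A product neighbourhood: the target set `V` around `y` must serve all parameters near `p₀` at
  -- once.
  rw [nhds_prod_eq, Filter.eventually_prod_iff] at hev
  obtain ⟨pa, hpa, pb, hpb, hab⟩ := hev
  obtain ⟨V, hVpb, hVo, hyV⟩ := eventually_nhds_iff.1 hpb
  set E : ℕ → Set (ℝ × ℂ) := fun n => {p : ℝ × ℂ | 0 < p.1 ∧ p.1 < 2 * p₀.1 ∧
      ‖(p.1 : ℂ) ^ (n + 1) * f (((S + p.2 • 1) ^ (n + 1)) x) - 1‖ < 1 / 2 ∧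
      f (((S + p.2 • 1) ^ (n + 1)) x) ≠ 0 ∧
      ‖f (((S + p.2 • 1) ^ (n + 2)) x) / f (((S + p.2 • 1) ^ (n + 1)) x)‖ ≤ 4 * K / p₀.1 ∧
      ‖f (((S + p.2 • 1) ^ (n + 2)) x) * f (((S + p.2 • 1) ^ n) x)‖ ≤
        ‖f (((S + p.2 • 1) ^ (n + 1)) x)‖ ^ 2 / 2} with hEdef
  have hnull : volume {p | ∃ᶠ n in Filter.atTop, p ∈ E n} = 0 := by
    refine measure_setOfPred_frequently_eq_zero (p := fun n p => p ∈ E n) (ne_top_of_le_ne_top ?_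
      (ENNReal.tsum_le_tsum fun n => volume_scaling_shift_set_le S x f hfx (2 * p₀.1)
        (4 * K / p₀.1) n))
    rw [ENNReal.tsum_mul_right]
    refine ENNReal.mul_ne_top ?_ measure_closedBall_lt_top.ne
    have hs : Summable fun n : ℕ => 8 * (2 * p₀.1) / ((n : ℝ) + 1) ^ 2 := by
      have h1 := (summable_nat_add_iff 1).2 (Real.summable_one_div_nat_pow.2 one_lt_two)
      simpa [div_eq_mul_inv] using h1.mul_left (8 * (2 * p₀.1))
    rw [← ENNReal.ofReal_tsum_of_nonneg (fun n => by positivity) hs]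
    exact ENNReal.ofReal_ne_top
  -- Each visit of the orbit to `V`, at time `n`, puts the parameter in `E n`.
  have hsub : {p | pa p} ⊆ {p | ∃ᶠ n in Filter.atTop, p ∈ E n} := by
    intro p hp
    have hpΩ : p ∈ Ω := (hab hp hpb.self_of_nhds).1
    refine ((hx p hpΩ).frequently_mem hVo ⟨y, hyV⟩).mono fun n hn => ?_
    obtain ⟨-, ha1, ha2, h1, h2, h3⟩ := hab hp (hVpb _ hn)
    dsimp only at ha1 ha2 h1 h2 h3
    have ha : 0 < p.1 := by linarith
    have hu : ∀ k, f (((T p) ^ k) x) = (p.1 : ℂ) ^ k * f (((S + p.2 • 1) ^ k) x) := by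
      intro k
      simp only [hT]
      rw [smul_pow, smul_apply, map_smul, smul_eq_mul]
    have e1 : T p (((T p) ^ n) x) = ((T p) ^ (n + 1)) x := by
      rw [pow_succ', mul_apply_eq_comp]
    have e2 : T p (((T p) ^ (n + 1)) x) = ((T p) ^ (n + 2)) x := by
      rw [pow_succ' _ (n + 1), mul_apply_eq_comp]
    change ‖f (T p (((T p) ^ n) x)) - 1‖ < 1 / 2 at h1
    change ‖f (T p (T p (((T p) ^ n) x)))‖ < K at h2
    change ‖f (T p (T p (((T p) ^ n) x))) * f (((T p) ^ n) x)‖ < 1 / 8 at h3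
    rw [e1, hu] at h1
    rw [e1, e2, hu] at h2
    rw [e1, e2, hu, hu] at h3
    exact ⟨ha, ha2, h1, scaling_estimates hp₀ ha1 h1 h2 h3⟩
  have hpos : 0 < volume {p | pa p} := Measure.measure_pos_of_mem_nhds _ hpa
  exact hpos.ne' (measure_mono_null hsub hnull)

end CommonHypercyclicFamily

/-! ### Transitivity and the Godefroy–Shapiro criterion -/

section GodefroyShapiro

open Filter Topology

variable {X : Type*} [NormedAddCommGroup X] [NormedSpace ℂ X]

/-- Birkhoff's transitivity theorem: a topologically transitive operator on a separable Banach space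
is hypercyclic. -/
theorem isHypercyclic_of_transitive [CompleteSpace X] [SecondCountableTopology X] (T : X →L[ℂ] X)
    (h : ∀ V W : Set X, IsOpen V → V.Nonempty → IsOpen W → W.Nonempty →
      ∃ n : ℕ, ∃ v ∈ V, (T ^ n) v ∈ W) : IsHypercyclic T := by
  obtain ⟨b, hbc, hb0, hb⟩ := TopologicalSpace.exists_countable_basis X
  have : Countable b := hbc
  -- Baire category: these vectors have orbits meeting every basic open set.
  have hd : Dense (⋂ s : b, ⋃ n : ℕ, (fun v => (T ^ n) v) ⁻¹' s.1) := by
    refine dense_iInter_of_isOpen (fun s => isOpen_iUnion fun n =>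
      (hb.isOpen s.2).preimage (T ^ n).continuous) fun s => ?_
    rw [dense_iff_inter_open]
    intro V hV hVne
    obtain ⟨n, v, hv, hn⟩ := h V s.1 hV hVne (hb.isOpen s.2)
      (Set.nonempty_iff_ne_empty.2 fun h0 => hb0 (h0 ▸ s.2))
    exact ⟨v, hv, Set.mem_iUnion.2 ⟨n, hn⟩⟩
  obtain ⟨x, hx⟩ := hd.nonempty
  refine ⟨x, hb.dense_iff.2 fun o ho _ => ?_⟩
  obtain ⟨n, hn⟩ := Set.mem_iUnion.1 (Set.mem_iInter.1 hx ⟨o, ho⟩)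
  exact ⟨_, hn, n, rfl⟩

theorem pow_apply_of_eigenvector {T : X →L[ℂ] X} {v : X} {l : ℂ} (h : T v = l • v) (n : ℕ) :
    (T ^ n) v = l ^ n • v := by
  induction n with
  | zero => simp
  | succ n ih => rw [pow_succ', mul_apply_eq_comp, ih, map_smul, h, smul_smul, pow_succ]

/-- The Godefroy–Shapiro criterion. -/
theorem isHypercyclic_of_eigenvectors [CompleteSpace X] [SecondCountableTopology X] (T : X →L[ℂ] X)
    {A B : Set X} (hA : ∀ v ∈ A, ∃ l : ℂ, ‖l‖ < 1 ∧ T v = l • v)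
    (hB : ∀ v ∈ B, ∃ l : ℂ, 1 < ‖l‖ ∧ T v = l • v)
    (hAd : Dense (Submodule.span ℂ A : Set X)) (hBd : Dense (Submodule.span ℂ B : Set X)) :
    IsHypercyclic T := by
  have hA' : ∀ v ∈ Submodule.span ℂ A, Tendsto (fun n : ℕ => (T ^ n) v) atTop (𝓝 0) := by
    intro v hv
    induction hv using Submodule.span_induction with
    | mem v hv =>
      obtain ⟨l, hl, h⟩ := hA v hv
      simp only [pow_apply_of_eigenvector h]
      simpa using (tendsto_pow_atTop_nhds_zero_of_norm_lt_one hl).smul_const v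
    | zero => simp only [map_zero, tendsto_const_nhds]
    | add v w _ _ hv hw => simpa only [map_add, add_zero] using hv.add hw
    | smul c v _ hv => simpa only [map_smul, smul_zero] using hv.const_smul c
  -- Eigenvalues outside the closed disc give backward orbits tending to `0`. Then `v + u n` stays
  -- near `v`, while `T ^ n` carries it near `w`.
  have hB' : ∀ v ∈ Submodule.span ℂ B, ∃ w : ℕ → X, Tendsto w atTop (𝓝 0) ∧
      ∀ n, (T ^ n) (w n) = v := by
    intro v hv
    induction hv using Submodule.span_induction with
    | mem v hv =>
      obtain ⟨l, hl, h⟩ := hB v hv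
      have hl0 : l ≠ 0 := fun h0 => by simp [h0] at hl; linarith
      refine ⟨fun n => l⁻¹ ^ n • v, ?_, fun n => ?_⟩
      · have : ‖l⁻¹‖ < 1 := by rw [norm_inv]; exact inv_lt_one_of_one_lt₀ hl
        simpa using (tendsto_pow_atTop_nhds_zero_of_norm_lt_one this).smul_const v
      · rw [map_smul, pow_apply_of_eigenvector h, smul_smul, ← mul_pow, inv_mul_cancel₀ hl0,
          one_pow, one_smul]
    | zero => exact ⟨fun _ => 0, tendsto_const_nhds, fun n => map_zero _⟩
    | add v w _ _ hv hw =>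
      obtain ⟨v', hv, hv'⟩ := hv
      obtain ⟨w', hw, hw'⟩ := hw
      exact ⟨fun n => v' n + w' n, by simpa using hv.add hw, fun n => by rw [map_add, hv', hw']⟩
    | smul c v _ hv =>
      obtain ⟨v', hv, hv'⟩ := hv
      exact ⟨fun n => c • v' n, by simpa using hv.const_smul c, fun n => by rw [map_smul, hv']⟩
  refine isHypercyclic_of_transitive T fun V W hV hVne hW hWne => ?_
  obtain ⟨v, hvA, hv⟩ := hAd.exists_mem_open hV hVne
  obtain ⟨w, hwB, hw⟩ := hBd.exists_mem_open hW hWne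
  obtain ⟨u, hu, huw⟩ := hB' w hwB
  have h1 : Tendsto (fun n => v + u n) atTop (𝓝 v) := by simpa using hu.const_add v
  have h2 : Tendsto (fun n => (T ^ n) (v + u n)) atTop (𝓝 w) := by
    simpa only [map_add, huw, zero_add] using (hA' v hvA).add_const w
  obtain ⟨n, hn1, hn2⟩ :=
    ((h1.eventually (hV.mem_nhds hv)).and (h2.eventually (hW.mem_nhds hw))).exists
  exact ⟨n, _, hn1, hn2⟩

end GodefroyShapiro

/-! ### Identity and open mapping theorems in several variables -/

section SeveralVariables

open Filter Topology

variable {E : Type*} [NormedAddCommGroup E] [NormedSpace ℂ E]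

/-- A function holomorphic on a ball, restricted to the complex line through two of its points. -/
theorem analyticOnNhd_comp_line {f : E → ℂ} {z : E} {r : ℝ}
    (hf : DifferentiableOn ℂ f (Metric.ball z r)) (w v : E) :
    AnalyticOnNhd ℂ (fun t : ℂ => f (w + t • v)) {t | w + t • v ∈ Metric.ball z r} ∧
      IsPreconnected {t : ℂ | w + t • v ∈ Metric.ball z r} := by
  have ho : IsOpen {t : ℂ | w + t • v ∈ Metric.ball z r} :=
    Metric.isOpen_ball.preimage (by fun_prop : Continuous fun t : ℂ => w + t • v)
  constructor
  · exact (hf.comp (by fun_prop : Differentiable ℂ fun t : ℂ => w + t • v).differentiableOn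
      fun t ht => ht).analyticOnNhd ho
  · refine Convex.isPreconnected ?_
    intro s hs t ht a b ha hb hab
    have h1 : w + (a • s + b • t) • v = a • (w + s • v) + b • (w + t • v) := by
      rw [smul_add, smul_add, add_smul, smul_assoc, smul_assoc, add_add_add_comm, ← add_smul, hab,
        one_smul]
    change w + (a • s + b • t) • v ∈ Metric.ball z r
    rw [h1]
    exact convex_ball z r hs ht ha hb hab

theorem eqOn_ball_of_eventuallyEq_const {f : E → ℂ} {z w : E} {r : ℝ}
    (hf : DifferentiableOn ℂ f (Metric.ball z r)) (hw : w ∈ Metric.ball z r) {k : ℂ}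
    (h : ∀ᶠ u in 𝓝 w, f u = k) : ∀ u ∈ Metric.ball z r, f u = k := by
  intro u hu
  obtain ⟨h1, h2⟩ := analyticOnNhd_comp_line hf w (u - w)
  have hc : Tendsto (fun t : ℂ => w + t • (u - w)) (𝓝 0) (𝓝 w) := by
    have : Continuous fun t : ℂ => w + t • (u - w) := by fun_prop
    simpa using this.tendsto 0
  have h3 := h1.eqOn_of_preconnected_of_eventuallyEq (g := fun _ => k) analyticOnNhd_const h2
    (z₀ := 0) (by simpa using hw) (hc.eventually h)
  simpa using h3 (show (1 : ℂ) ∈ {t : ℂ | w + t • (u - w) ∈ Metric.ball z r} by simpa using hu)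

/-- The identity theorem for holomorphic functions of several variables. -/
theorem eqOn_of_isPreconnected_of_eventuallyEq_const {f : E → ℂ} {U : Set E} (hU : IsOpen U)
    (hUc : IsPreconnected U) (hf : DifferentiableOn ℂ f U) {z₀ : E} (hz₀ : z₀ ∈ U) {k : ℂ}
    (h : ∀ᶠ u in 𝓝 z₀, f u = k) : ∀ u ∈ U, f u = k := by
  have hsub : U ⊆ {z | ∀ᶠ u in 𝓝 z, f u = k} := by
    -- The set where `f` is locally equal to `k` is open, and relatively closed in `U` by the case
    -- of a ball.
    refine hUc.subset_of_closure_inter_subset isOpen_setOfPred_eventually_nhds ⟨z₀, hz₀, h⟩ ?_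
    rintro z ⟨hz, hzU⟩
    obtain ⟨r, hr, hrU⟩ := Metric.isOpen_iff.1 hU z hzU
    obtain ⟨w, hw, hwz⟩ := Metric.mem_closure_iff.1 hz r hr
    have h1 := eqOn_ball_of_eventuallyEq_const (hf.mono hrU) (Metric.mem_ball'.2 hwz) hw
    exact Filter.mem_of_superset (Metric.ball_mem_nhds z hr) h1
  exact fun u hu => (hsub hu).self_of_nhds

/-- The open mapping theorem for holomorphic functions of several variables. -/
theorem image_mem_nhds_of_not_eventually_const {f : E → ℂ} {U : Set E} (hU : IsOpen U)
    (hf : DifferentiableOn ℂ f U) {z₀ : E} (hz₀ : z₀ ∈ U) (h : ¬ ∀ᶠ u in 𝓝 z₀, f u = f z₀) :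
    f '' U ∈ 𝓝 (f z₀) := by
  obtain ⟨r, hr, hrU⟩ := Metric.isOpen_iff.1 hU z₀ hz₀
  -- On the complex line through `z₀` and `v` the function is non-constant, so the one-variable open
  -- mapping theorem applies.
  obtain ⟨v, hv, hvz⟩ : ∃ v ∈ Metric.ball z₀ r, f v ≠ f z₀ := by
    by_contra! h1
    exact h (Filter.mem_of_superset (Metric.ball_mem_nhds z₀ hr) h1)
  obtain ⟨h1, h2⟩ := analyticOnNhd_comp_line (hf.mono hrU) z₀ (v - z₀)
  have h0 : (0 : ℂ) ∈ {t : ℂ | z₀ + t • (v - z₀) ∈ Metric.ball z₀ r} := by simpa using hr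
  have ho : IsOpen {t : ℂ | z₀ + t • (v - z₀) ∈ Metric.ball z₀ r} :=
    Metric.isOpen_ball.preimage (by fun_prop : Continuous fun t : ℂ => z₀ + t • (v - z₀))
  rcases (h1 0 h0).eventually_constant_or_nhds_le_map_nhds with h3 | h3
  · have h4 := h1.eqOn_of_preconnected_of_eventuallyEq analyticOnNhd_const h2 h0 h3
    have h5 := h4 (show (1 : ℂ) ∈ {t : ℂ | z₀ + t • (v - z₀) ∈ Metric.ball z₀ r} by
      simpa [dist_eq_norm] using hv)
    exact absurd (by simpa using h5) hvz
  · have h4 := h3 (Filter.image_mem_map (ho.mem_nhds h0))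
    simp only [zero_smul, add_zero] at h4
    refine Filter.mem_of_superset h4 ?_
    rintro _ ⟨t, ht, rfl⟩
    exact ⟨_, hrU ht, rfl⟩

end SeveralVariables

/-! ### Adjoint multiplication operators and reproducing kernels -/

section Multiplier

open Filter Topology

variable {X : Type*} {H : Type*} [NormedAddCommGroup H] [InnerProductSpace ℂ H] [RKHS ℂ H X ℂ]
  [CompleteSpace H]

theorem mulOp_affine {φ : X → ℂ} (hφ : IsMultiplier H φ) (c a : ℂ) :
    mulOp (hφ.affine c a) = c • 1 + a • mulOp hφ := by
  ext f : 1
  refine RKHS.ext fun z => ?_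
  simp only [mulOp_apply, add_apply, smul_apply, one_apply_eq_self, RKHS.coe_add, RKHS.coe_smul,
    Pi.add_apply, Pi.smul_apply, smul_eq_mul]
  ring

theorem adjMulOp_affine {φ : X → ℂ} (hφ : IsMultiplier H φ) (c a : ℂ) :
    adjMulOp (hφ.affine c a) = conj c • 1 + conj a • adjMulOp hφ := by
  ext f : 1
  refine ext_inner_right ℂ fun g => ?_
  rw [adjMulOp, ContinuousLinearMap.adjoint_inner_left, mulOp_affine hφ]
  simp only [add_apply, smul_apply, one_apply_eq_self, adjMulOp, inner_add_left, inner_add_right,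
    inner_smul_left, inner_smul_right, ContinuousLinearMap.adjoint_inner_left, Complex.conj_conj]

theorem adjMulOp_kerFun {φ : X → ℂ} (hφ : IsMultiplier H φ) (z : X) :
    adjMulOp hφ (RKHS.kerFun H z (1 : ℂ)) = conj (φ z) • RKHS.kerFun H z (1 : ℂ) := by
  refine ext_inner_right ℂ fun f => ?_
  rw [adjMulOp, ContinuousLinearMap.adjoint_inner_left, inner_smul_left, RKHS.kerFun_inner,
    RKHS.kerFun_inner, mulOp_apply]
  simp

/-- Orthogonality to the kernel at `z` means vanishing at `z`, so the orthogonal complement of the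
span is zero. -/
theorem dense_span_kerFun_of_forall {s : Set X} (hs : ∀ f : H, (∀ z ∈ s, f z = 0) → f = 0) :
    Dense (Submodule.span ℂ ((fun z => RKHS.kerFun H z (1 : ℂ)) '' s) : Set H) := by
  rw [Submodule.dense_iff_topologicalClosure_eq_top, Submodule.topologicalClosure_eq_top_iff,
    Submodule.eq_bot_iff]
  intro f hf
  refine hs f fun z hz => ?_
  have := Submodule.inner_right_of_mem_orthogonal
    (Submodule.subset_span (Set.mem_image_of_mem _ hz)) hf
  simpa using this

end Multiplier

/-! ### Holomorphic function Hilbert spaces -/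

section FunctionHilbertSpace

open Filter Topology

variable {m : ℕ} {U : Set (EuclideanSpace ℂ (Fin m))}

open Classical in
/-- The extension of a function on `U` by zero. -/
noncomputable def extendZero (f : U → ℂ) (z : EuclideanSpace ℂ (Fin m)) : ℂ :=
  if h : z ∈ U then f ⟨z, h⟩ else 0

theorem extendZero_of_mem (f : U → ℂ) {z : EuclideanSpace ℂ (Fin m)} (hz : z ∈ U) :
    extendZero f z = f ⟨z, hz⟩ :=
  dif_pos hz

theorem extendZero_coe (f : U → ℂ) (z : U) : extendZero f z = f z :=
  extendZero_of_mem f z.2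

theorem IsHolomorphic.differentiableOn_extendZero {f : U → ℂ} (hf : IsHolomorphic f) :
    DifferentiableOn ℂ (extendZero f) U := by
  obtain ⟨F, hF, hFf⟩ := hf
  exact hF.congr fun z hz => (extendZero_coe f ⟨z, hz⟩).trans (hFf ⟨z, hz⟩).symm

theorem IsHolomorphic.eq_const_of_eventually (hU : IsOpen U) (hUc : IsConnected U) {f : U → ℂ}
    (hf : IsHolomorphic f) {z₀ : EuclideanSpace ℂ (Fin m)} (hz₀ : z₀ ∈ U) {k : ℂ}
    (h : ∀ᶠ z in 𝓝 z₀, extendZero f z = k) (z : U) : f z = k := by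
  rw [← extendZero_coe f z]
  exact eqOn_of_isPreconnected_of_eventuallyEq_const hU hUc.isPreconnected
    hf.differentiableOn_extendZero hz₀ h z z.2

variable {H : Type*} [NormedAddCommGroup H] [InnerProductSpace ℂ H] [CompleteSpace H]
  [RKHS ℂ H U ℂ] [FunctionHilbertSpace U H]

theorem eq_zero_of_eventually_eq_zero (hU : IsOpen U) (hUc : IsConnected U) (f : H)
    {z₀ : EuclideanSpace ℂ (Fin m)} (hz₀ : z₀ ∈ U) (h : ∀ᶠ z in 𝓝 z₀, extendZero (U := U) f z = 0) :
    f = 0 :=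
  RKHS.ext fun z => by
    rw [RKHS.coe_zero]
    exact (FunctionHilbertSpace.holomorphic f).eq_const_of_eventually hU hUc hz₀ h z

/-- Elements of `H` are continuous, so kernels at a countable dense set of points span densely.
Birkhoff's theorem needs this separability. -/
theorem FunctionHilbertSpace.secondCountableTopology (U : Set (EuclideanSpace ℂ (Fin m)))
    (H : Type*) [NormedAddCommGroup H] [InnerProductSpace ℂ H] [CompleteSpace H] [RKHS ℂ H U ℂ]
    [FunctionHilbertSpace U H] : SecondCountableTopology H := by
  obtain ⟨D, hDc, hDd⟩ := TopologicalSpace.exists_countable_dense U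
  have h1 : Dense (Submodule.span ℂ ((fun z => RKHS.kerFun H z (1 : ℂ)) '' D) : Set H) := by
    refine dense_span_kerFun_of_forall fun f hf => RKHS.ext fun z => ?_
    have hc : Continuous fun z : U => f z := by
      have h2 := (FunctionHilbertSpace.holomorphic (U := U) f).differentiableOn_extendZero.continuousOn
      rw [continuousOn_iff_continuous_domRestrict] at h2
      refine h2.congr fun z => ?_
      exact extendZero_coe (U := U) f z
    rw [RKHS.coe_zero]
    exact congrFun (hc.ext_on hDd continuous_const hf) z
  have h2 : TopologicalSpace.SeparableSpace H := by
    have h3 := ((hDc.image fun z => RKHS.kerFun H z (1 : ℂ)).isSeparable.span (R := ℂ)).closure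
    rw [h1.closure_eq] at h3
    exact TopologicalSpace.isSeparable_univ_iff.1 h3
  exact UniformSpace.secondCountable_of_separable H

/-- A multiplier is holomorphic near the points that are not common zeros. -/
theorem IsMultiplier.differentiableAt_extendZero (hU : IsOpen U) {φ : U → ℂ}
    (hφ : IsMultiplier H φ) (f : H) {z₀ : U} (hf : f z₀ ≠ 0) :
    DifferentiableAt ℂ (extendZero φ) z₀ := by
  have hd : ∀ g : H, DifferentiableAt ℂ (extendZero (U := U) g) z₀ := fun g =>
    ((FunctionHilbertSpace.holomorphic g).differentiableOn_extendZero).differentiableAt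
      (hU.mem_nhds z₀.2)
  have hf' : extendZero (U := U) f z₀ ≠ 0 := by rwa [extendZero_coe]
  obtain ⟨g, hg⟩ := hφ f
  -- Near `z₀` the multiplier is the quotient `g / f`, with `g = φ f`.
  refine ((hd g).mul ((hd f).inv hf')).congr_of_eventuallyEq ?_
  filter_upwards [hU.mem_nhds z₀.2, (hd f).continuousAt.eventually_ne hf'] with z hz hfz
  rw [Pi.mul_apply, Pi.inv_apply, ← div_eq_mul_inv, eq_div_iff hfz, extendZero_of_mem _ hz,
    extendZero_of_mem _ hz, extendZero_of_mem _ hz, hg]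

theorem IsMultiplier.isHolomorphic (hU : IsOpen U) {φ : U → ℂ} (hφ : IsMultiplier H φ)
    (h0 : ∀ z : U, ∃ f : H, f z ≠ 0) : IsHolomorphic φ := by
  refine ⟨extendZero φ, fun z hz => ?_, extendZero_coe φ⟩
  obtain ⟨f, hf⟩ := h0 ⟨z, hz⟩
  exact (hφ.differentiableAt_extendZero hU f hf).differentiableWithinAt

/-- A multiplier that is locally constant at some point where not all of `H` vanishes induces a
scalar multiplication operator. -/
theorem mulOp_eq_smul_of_eventually_const (hU : IsOpen U) (hUc : IsConnected U) {φ : U → ℂ}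
    (hφ : IsMultiplier H φ) {z₀ : U} {k : ℂ} (h : ∀ᶠ z in 𝓝 (z₀ : EuclideanSpace ℂ (Fin m)),
      extendZero φ z = k) (f : H) : mulOp hφ f = k • f := by
  rw [← sub_eq_zero]
  refine eq_zero_of_eventually_eq_zero hU hUc _ z₀.2 ?_
  filter_upwards [h, hU.mem_nhds z₀.2] with z hz hzU
  rw [extendZero_of_mem _ hzU] at hz ⊢
  rw [RKHS.coe_sub, RKHS.coe_smul, Pi.sub_apply, Pi.smul_apply, mulOp_apply, hz, smul_eq_mul,
    sub_self]

/-- Kernels are eigenvectors with eigenvalues `conj (ψ z)`. By the open mapping theorem `ψ` takes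
values on both sides of the unit circle, and by the identity theorem the kernels from either side
already span densely. -/
theorem isHypercyclic_adjMulOp (hU : IsOpen U) (hUc : IsConnected U) {ψ : U → ℂ}
    (hψ : IsMultiplier H ψ) (hol : IsHolomorphic ψ) (hnc : ∃ z w : U, ψ z ≠ ψ w)
    (hr : (Set.range ψ ∩ Metric.sphere (0 : ℂ) 1).Nonempty) : IsHypercyclic (adjMulOp hψ) := by
  have := FunctionHilbertSpace.secondCountableTopology U H
  obtain ⟨_, ⟨z₀, rfl⟩, hz₀⟩ := hr
  rw [mem_sphere_zero_iff_norm] at hz₀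
  have himg := image_mem_nhds_of_not_eventually_const hU hol.differentiableOn_extendZero z₀.2
    (fun h => by
      obtain ⟨z, w, hzw⟩ := hnc
      exact hzw ((hol.eq_const_of_eventually hU hUc z₀.2 h z).trans
        (hol.eq_const_of_eventually hU hUc z₀.2 h w).symm))
  rw [extendZero_coe] at himg
  have hex : ∀ O : Set ℂ, IsOpen O → ψ z₀ ∈ closure O → ∃ z : U, ψ z ∈ O := by
    intro O hO hcl
    obtain ⟨v, hv, z, hz, rfl⟩ := mem_closure_iff_nhds.1 hcl _ himg |>.imp fun v hv => hv.symm
    exact ⟨⟨z, hz⟩, by rwa [← extendZero_coe ψ ⟨z, hz⟩]⟩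
  have hdense : ∀ O : Set ℂ, IsOpen O → ψ z₀ ∈ closure O →
      Dense (Submodule.span ℂ ((fun z => RKHS.kerFun H z (1 : ℂ)) '' {z : U | ψ z ∈ O}) : Set H) := by
    intro O hO hcl
    obtain ⟨z₁, hz₁⟩ := hex O hO hcl
    refine dense_span_kerFun_of_forall fun f hf => eq_zero_of_eventually_eq_zero hU hUc f z₁.2 ?_
    have hc := (hol.differentiableOn_extendZero.differentiableAt (hU.mem_nhds z₁.2)).continuousAt
    filter_upwards [hU.mem_nhds z₁.2, hc.preimage_mem_nhds
      (hO.mem_nhds (by rwa [extendZero_coe]))] with z hz hzO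
    rw [Set.mem_preimage, show z = ((⟨z, hz⟩ : U) : EuclideanSpace ℂ (Fin m)) from rfl,
      extendZero_coe] at hzO
    exact (extendZero_coe (U := U) f ⟨z, hz⟩).trans (hf _ hzO)
  have hin : ψ z₀ ∈ closure (Metric.ball (0 : ℂ) 1) := by
    rw [closure_ball _ one_ne_zero]
    exact mem_closedBall_zero_iff.2 hz₀.le
  have hout : ψ z₀ ∈ closure (Metric.closedBall (0 : ℂ) 1)ᶜ := by
    rw [closure_compl, interior_closedBall _ one_ne_zero]
    simp [hz₀]
  refine isHypercyclic_of_eigenvectors _ ?_ ?_ (hdense _ Metric.isOpen_ball hin)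
    (hdense _ Metric.isClosed_closedBall.isOpen_compl hout)
  · rintro _ ⟨z, hz, rfl⟩
    refine ⟨conj (ψ z), ?_, adjMulOp_kerFun hψ z⟩
    rw [RCLike.norm_conj]
    exact mem_ball_zero_iff.1 hz
  · rintro _ ⟨z, hz, rfl⟩
    refine ⟨conj (ψ z), ?_, adjMulOp_kerFun hψ z⟩
    rw [RCLike.norm_conj]
    simpa using hz

/-- At common zeros of `H` a multiplier can take arbitrary values, so the argument is local, around
a point where some `f₀` does not vanish and `φ` is holomorphic. -/
theorem not_common_isHypercyclicVector_adjMulOp [Nontrivial H] (hU : IsOpen U)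
    (hUc : IsConnected U) {φ : U → ℂ} (hφ : IsMultiplier H φ) :
    ¬ ∃ x : H, ∀ (a : ℝ) (b : ℂ), 0 < a →
      (Set.range (fun z : U => conj b + (a : ℂ) * φ z) ∩ Metric.sphere (0 : ℂ) 1).Nonempty →
      IsHypercyclicVector (adjMulOp (hφ.affine (conj b) a)) x := by
  rintro ⟨x, hx⟩
  obtain ⟨f₀, hf₀⟩ := exists_ne (0 : H)
  obtain ⟨z₀, hz₀⟩ : ∃ z : U, f₀ z ≠ 0 := by
    by_contra! h
    exact hf₀ (RKHS.ext fun z => by rw [h z, RKHS.coe_zero, Pi.zero_apply])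
  have hmem : ∀ (a : ℝ) (c : ℂ) (z : U), (a : ℂ) * (conj c + φ z) = 1 →
      (Set.range (fun z : U => conj (a * c) + (a : ℂ) * φ z) ∩
        Metric.sphere (0 : ℂ) 1).Nonempty := by
    intro a c z h
    refine ⟨1, ⟨z, ?_⟩, by simp⟩
    rw [← h, map_mul, Complex.conj_ofReal, mul_add]
  have hop : ∀ (a : ℝ) (c : ℂ), adjMulOp (hφ.affine (conj ((a : ℂ) * c)) a) =
      (a : ℂ) • (adjMulOp hφ + c • 1) := by
    intro a c
    rw [adjMulOp_affine, Complex.conj_conj, Complex.conj_ofReal, smul_add, smul_smul, add_comm]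
  -- Chosen so that `a (conj c + φ z₀) = 1`, a point of the unit circle, at `(a, c) = (1, c₀)`.
  set c₀ : ℂ := conj (1 - φ z₀) with hc₀
  have h₀ : conj c₀ = 1 - φ z₀ := by rw [hc₀, Complex.conj_conj]
  -- If `φ` is locally constant here, the operators are scalar and every functional is an
  -- eigenvector of the dual.
  by_cases hconst : ∀ᶠ z in 𝓝 (z₀ : EuclideanSpace ℂ (Fin m)), extendZero φ z = φ z₀
  · have h1 := hx 1 ((1 : ℝ) * c₀) one_pos (hmem 1 c₀ z₀ (by rw [h₀]; simp))
    obtain ⟨g, hg⟩ : ∃ g : H →L[ℂ] ℂ, g f₀ ≠ 0 := SeparatingDual.exists_ne_zero hf₀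
    have hadj : adjMulOp hφ = conj (φ z₀) • 1 := by
      have h2 : mulOp hφ = φ z₀ • 1 := by
        ext f : 1
        exact mulOp_eq_smul_of_eventually_const hU hUc hφ hconst f
      ext v : 1
      refine ext_inner_right ℂ fun g => ?_
      rw [adjMulOp, ContinuousLinearMap.adjoint_inner_left, h2]
      simp [inner_smul_left, inner_smul_right]
    have h2 := h1.eq_zero_of_eigenfunctional (f := g) (l := conj (φ z₀) + c₀) (fun v => by
      rw [hop, hadj, Complex.ofReal_one, one_smul, ← add_smul]
      simp)
    exact hg (by rw [h2]; rfl)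
  · set N : Set (EuclideanSpace ℂ (Fin m)) := U ∩ {z | extendZero (U := U) f₀ z ≠ 0} with hN
    have hNo : IsOpen N :=
      (FunctionHilbertSpace.holomorphic f₀).differentiableOn_extendZero.continuousOn
        |>.isOpen_inter_preimage hU isOpen_compl_singleton
    have hNz : (z₀ : EuclideanSpace ℂ (Fin m)) ∈ N := ⟨z₀.2, by
      change extendZero (U := U) f₀ z₀ ≠ 0
      rwa [extendZero_coe]⟩
    have hNd : DifferentiableOn ℂ (extendZero φ) N := by
      rintro z ⟨hz, hfz⟩
      refine (hφ.differentiableAt_extendZero hU f₀ (z₀ := ⟨z, hz⟩) ?_).differentiableWithinAt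
      rwa [← extendZero_coe (U := U) f₀ ⟨z, hz⟩]
    have himg := image_mem_nhds_of_not_eventually_const hNo hNd hNz (by rwa [extendZero_coe])
    rw [extendZero_coe] at himg
    -- The equation `a (conj c + φ z) = 1` reads `φ z = a⁻¹ - conj c`; it stays solvable near `(1,
    -- c₀)` since `φ` covers a neighbourhood of `φ z₀`.
    have hcont : ContinuousAt (fun p : ℝ × ℂ => (p.1 : ℂ)⁻¹ - conj p.2) (1, c₀) := by
      refine ContinuousAt.sub (ContinuousAt.inv₀ (by fun_prop) (by simp)) ?_
      exact (Complex.continuous_conj.comp continuous_snd).continuousAt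
    have hval : (((1 : ℝ), c₀).1 : ℂ)⁻¹ - conj ((1 : ℝ), c₀).2 = φ z₀ := by
      simp only [h₀]; simp
    have hΩ : {p : ℝ × ℂ | 0 < p.1 ∧ ∃ z : U, (p.1 : ℂ) * (conj p.2 + φ z) = 1} ∈
        𝓝 ((1 : ℝ), c₀) := by
      have h1 : ∀ᶠ p : ℝ × ℂ in 𝓝 ((1 : ℝ), c₀), 0 < p.1 :=
        continuous_fst.continuousAt.eventually (lt_mem_nhds one_pos)
      filter_upwards [h1, hcont.preimage_mem_nhds (by rw [hval]; exact himg)] with p hp hpz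
      obtain ⟨z, hz, hzp⟩ := hpz
      refine ⟨hp, ⟨z, hz.1⟩, ?_⟩
      rw [← extendZero_coe φ ⟨z, hz.1⟩]
      change (p.1 : ℂ) * (conj p.2 + extendZero φ z) = 1
      rw [hzp, add_sub_cancel, mul_inv_cancel₀ (Complex.ofReal_ne_zero.2 hp.ne')]
    refine not_common_isHypercyclicVector (adjMulOp hφ) hΩ one_pos ⟨x, ?_⟩
    rintro ⟨a, c⟩ ⟨ha, z, hz⟩
    have h1 := hx a (a * c) ha (hmem a c z hz)
    rwa [hop] at h1

end FunctionHilbertSpace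

theorem mainTheorem12 {m : ℕ} (U : Set (EuclideanSpace ℂ (Fin m)))
    (hUo : IsOpen U) (hUc : IsConnected U)
    (H : Type*) [NormedAddCommGroup H] [InnerProductSpace ℂ H] [CompleteSpace H]
    [RKHS ℂ H U ℂ] [FunctionHilbertSpace U H] [Nontrivial H]
    (φ : U → ℂ) (hφ : IsMultiplier H φ) (hnc : ∃ z w : U, φ z ≠ φ w) :
    -- the family has no common hypercyclic vector
    (¬ ∃ x : H, ∀ (a : ℝ) (b : ℂ), 0 < a →
      (Set.range (fun z : U => conj b + (a : ℂ) * φ z) ∩ Metric.sphere (0 : ℂ) 1).Nonempty →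
      IsHypercyclicVector (adjMulOp (hφ.affine (conj b) a)) x) ∧
    -- unless `φ` is not holomorphic and `H` has a common zero,
    ((IsHolomorphic φ ∨ ∀ z : U, ∃ f : H, f z ≠ 0) →
      -- the members of the family are hypercyclic,
      (∀ (a : ℝ) (b : ℂ), 0 < a →
        (Set.range (fun z : U => conj b + (a : ℂ) * φ z) ∩ Metric.sphere (0 : ℂ) 1).Nonempty →
        IsHypercyclic (adjMulOp (hφ.affine (conj b) a))) ∧
      -- and no vector is hypercyclic for all hypercyclic adjoint multiplication operators on `H`
      ¬ ∃ x : H, ∀ (ψ : U → ℂ) (hψ : IsMultiplier H ψ),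
        IsHypercyclic (adjMulOp hψ) → IsHypercyclicVector (adjMulOp hψ) x) := by
  have hno := not_common_isHypercyclicVector_adjMulOp hUo hUc hφ
  refine ⟨hno, fun h => ?_⟩
  have hol : IsHolomorphic φ := h.elim id (hφ.isHolomorphic hUo)
  have hhyp : ∀ (a : ℝ) (b : ℂ), 0 < a →
      (Set.range (fun z : U => conj b + (a : ℂ) * φ z) ∩ Metric.sphere (0 : ℂ) 1).Nonempty →
      IsHypercyclic (adjMulOp (hφ.affine (conj b) a)) := by
    intro a b ha hr
    refine isHypercyclic_adjMulOp hUo hUc _ ?_ ?_ hr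
    · obtain ⟨F, hF, hFφ⟩ := hol
      exact ⟨fun z => conj b + (a : ℂ) * F z, (hF.const_mul (a : ℂ)).const_add (conj b),
        fun z => congrArg (fun w => conj b + (a : ℂ) * w) (hFφ z)⟩
    · obtain ⟨z, w, hzw⟩ := hnc
      refine ⟨z, w, fun h => hzw ?_⟩
      exact mul_left_cancel₀ (Complex.ofReal_ne_zero.2 ha.ne') (add_left_cancel h)
  refine ⟨hhyp, ?_⟩
  rintro ⟨x, hx⟩
  exact hno ⟨x, fun a b ha hr => hx _ _ (hhyp a b ha hr)⟩
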